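/- Let $A=(A_i)_{i\in I}$ be a finite cover, that is, a family of sets indexed by a finite set $I$. The nerve $N(A)$ is the simplicial complex whose simplices are the nonempty sets $\sigma\subset I$ with $A_\sigma:=\bigcap_{i\in\sigma}A_i\neq\varnothing$; it is identified with its face poset, ordered by inclusion. Let $P\subset N(A)$ be a subposet, and let $N(A^P)$ be the nerve of the family $A^P=(A_\sigma)_{\sigma\in P}$, indexed by $P$. For a finite poset $Q$, let $\Delta(Q)$ be its order complex, whose simplices are the nonempty chains of $Q$; an order-preserving map $f\colon Q\to Q'$ induces a simplicial map $\Delta(f)\colon\Delta(Q)\to\Delta(Q')$ by applying $f$ to vertices. Suppose that $\sigma_1\cup\dots\cup\sigma_m\in P$ for every simplex $\{\sigma_1,\dots,\sigma_m\}\in N(A^P)$. Then $F(\{\sigma_1,\dots,\sigma_m\})=\sigma_1\cup\dots\cup\sigma_m$ defines an order-preserving map $F\colon N(A^P)\to P$, and $\Delta(F)\colon\Delta(N(A^P))\to\Delta(P)$ induces a homotopy equivalence of geometric realizations. -/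

import Mathlib

namespace SubposetNerve

/-! ### Finite simplicial complexes and their geometric realizations -/

/-- The geometric realization of a simplicial complex with finitely many vertices: the points are
the families of barycentric coordinates (nonnegative, with sum `1`) supported on some face. As a
set of functions `V → ℝ` it carries the subspace topology of the product topology; since `V` is
finite, this is the usual topology of the realization. -/
def realization {V : Type*} [Finite V] (K : PreAbstractSimplicialComplex V) : Set (V → ℝ) :=
  {x | (∀ v, 0 ≤ x v) ∧ ∃ s ∈ K.faces, (∀ v, v ∉ s → x v = 0) ∧ ∑ v ∈ s, x v = 1}

/-- A simplicial map: a map of vertices for which the image of every face is a face. -/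
structure SimplicialMap {V W : Type*} (K : PreAbstractSimplicialComplex V)
    (L : PreAbstractSimplicialComplex W) where
  toFun : V → W
  map_faces : ∀ s ∈ K.faces, ∃ t ∈ L.faces, (t : Set W) = toFun '' (s : Set V)

/-- The affine extension of a map of vertices to barycentric coordinates: the coordinate of the
image at `w` is the sum of the coordinates at the vertices that are sent to `w`. -/
noncomputable def pushCoord {V W : Type*} (f : V → W) (x : V → ℝ) : W → ℝ :=
  fun w => ∑ᶠ v ∈ f ⁻¹' {w}, x v

theorem pushCoord_mem {V W : Type*} [Finite V] [Finite W] {K : PreAbstractSimplicialComplex V}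
    {L : PreAbstractSimplicialComplex W} (f : SimplicialMap K L) {x : V → ℝ}
    (hx : x ∈ realization K) : pushCoord f.toFun x ∈ realization L := by
  classical
  obtain ⟨h0, s, hs, hsupp, hsum⟩ := hx
  obtain ⟨t, ht, hts⟩ := f.map_faces s hs
  have hpush : ∀ w, pushCoord f.toFun x w = ∑ v ∈ s with f.toFun v = w, x v := by
    intro w
    refine finsum_mem_eq_sum_of_inter_support_eq _ ?_
    ext v
    simp only [Set.mem_inter_iff, Set.mem_preimage, Set.mem_singleton_iff, Function.mem_support,
      Finset.coe_filter, Set.mem_ofPred_eq]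
    constructor
    · rintro ⟨h1, h2⟩
      exact ⟨⟨by_contra fun h => h2 (hsupp v h), h1⟩, h2⟩
    · rintro ⟨⟨_, h1⟩, h2⟩
      exact ⟨h1, h2⟩
  refine ⟨fun w => ?_, t, ht, fun w hw => ?_, ?_⟩
  · rw [hpush]
    exact Finset.sum_nonneg fun v _ => h0 v
  · rw [hpush]
    refine Finset.sum_eq_zero fun v hv => ?_
    obtain ⟨hvs, rfl⟩ := Finset.mem_filter.1 hv
    refine absurd ?_ hw
    rw [← Finset.mem_coe, hts]
    exact ⟨v, Finset.mem_coe.2 hvs, rfl⟩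
  · simp only [hpush]
    rw [← hsum]
    refine Finset.sum_fiberwise_of_maps_to (fun v hv => ?_) x
    rw [← Finset.mem_coe, hts]
    exact ⟨v, hv, rfl⟩

theorem continuous_pushCoord {V W : Type*} [Finite V] (f : V → W) :
    Continuous (pushCoord f) := by
  classical
  have := Fintype.ofFinite V
  refine continuous_pi fun w => ?_
  have : (fun x : V → ℝ => pushCoord f x w) = fun x => ∑ v with f v = w, x v := by
    funext x
    exact finsum_mem_eq_sum_of_inter_support_eq _ (by ext v; simp)
  rw [this]
  fun_prop

/-- The continuous map of realizations induced by a simplicial map. -/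
noncomputable def SimplicialMap.realize {V W : Type*} [Finite V] [Finite W]
    {K : PreAbstractSimplicialComplex V} {L : PreAbstractSimplicialComplex W}
    (f : SimplicialMap K L) : C(realization K, realization L) where
  toFun x := ⟨pushCoord f.toFun x.1, pushCoord_mem f x.2⟩
  continuous_toFun :=
    ((continuous_pushCoord f.toFun).comp continuous_subtype_val).subtype_mk _

/-! ### Order complexes -/

/-- The order complex of a poset: its vertices are the elements of `P`, and its faces are the
nonempty finite chains. -/
def orderComplex (P : Type*) [PartialOrder P] : PreAbstractSimplicialComplex P where
  faces := {s | s.Nonempty ∧ IsChain (· ≤ ·) (s : Set P)}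
  isRelLowerSet_faces := fun _ hs =>
    ⟨hs.1, fun _ hts ht => ⟨ht, hs.2.mono (Finset.coe_subset.2 hts)⟩⟩

/-- The simplicial map of order complexes induced by an order-preserving map. -/
def orderComplexMap {P Q : Type*} [PartialOrder P] [PartialOrder Q] (f : P →o Q) :
    SimplicialMap (orderComplex P) (orderComplex Q) where
  toFun := f
  map_faces s hs := by
    classical
    refine ⟨s.image f, ⟨hs.1.image f, ?_⟩, Finset.coe_image⟩
    rw [Finset.coe_image]
    exact hs.2.image_of_map_rel _ _ _ (fun _ _ h => f.monotone h)

/-! ### Nerves -/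

/-- The nerve of a family of sets: the faces are the nonempty finite sets of indices for which
the sets of the family have a common point. The face poset of the nerve is its set of faces,
ordered by inclusion. -/
def nerve {X I : Type*} (A : I → Set X) : PreAbstractSimplicialComplex I where
  faces := {s | s.Nonempty ∧ (⋂ i ∈ s, A i).Nonempty}
  isRelLowerSet_faces := fun _ hs =>
    ⟨hs.1, fun _ hts ht => ⟨ht, hs.2.mono (Set.biInter_subset_biInter_left hts)⟩⟩

/-- The family `(A_σ)_{σ ∈ P}` with `A_σ = ⋂_{i ∈ σ} A_i`, indexed by a set `P` of finite sets of
indices. -/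
def inducedCover {X I : Type*} (A : I → Set X) (P : Set (Finset I)) : P → Set X :=
  fun σ => ⋂ i ∈ σ.1, A i

/-! ### Homotopy equivalences -/

/-- A continuous map is a homotopy equivalence if it has an inverse up to homotopy. -/
def IsHomotopyEquivalence {X Y : Type*} [TopologicalSpace X] [TopologicalSpace Y]
    (f : C(X, Y)) : Prop :=
  ∃ g : C(Y, X), (g.comp f).Homotopic (ContinuousMap.id X) ∧
    (f.comp g).Homotopic (ContinuousMap.id Y)

end SubposetNerve

/-!
The union map `F : N(A^P) → P` has an upper adjoint: since `A_σ ⊆ A_τ` for `τ ⊆ σ`, the set of all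
`τ ∈ P` with `τ ⊆ σ` is a simplex `G σ` of `N(A^P)`, and `⋃ S ⊆ σ` if and only if `S ⊆ G σ`. Hence
`id ≤ G ∘ F` and `F ∘ G ≤ id`, and it remains to see that comparable order-preserving maps
`f ≤ g : P → Q` induce homotopic maps. Such a pair is an order-preserving map `P × {0 < 1} → Q`, so
it is enough to join the two inclusions `P → P × {0 < 1}` by a homotopy: a point of `Δ(P)` is a
distribution of mass along a chain, and during the homotopy its mass is lifted from level `0` to
level `1` starting with the largest element of the chain. At every time the lifted mass lies above
the mass that stays behind, so the support remains a chain.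
-/

namespace SubposetNerve

section Functoriality

theorem pushCoord_id {V : Type*} (x : V → ℝ) : pushCoord id x = x := by
  funext w
  simp [pushCoord]

theorem pushCoord_comp {U V W : Type*} [Finite U] [Finite V] (g : V → W) (f : U → V)
    (x : U → ℝ) : pushCoord (g ∘ f) x = pushCoord g (pushCoord f x) := by
  funext w
  unfold pushCoord
  rw [Set.preimage_comp, ← Set.biUnion_preimage_singleton f,
    finsum_mem_biUnion (Set.pairwiseDisjoint_fiber f _) (Set.toFinite _) fun _ _ => Set.toFinite _]

variable {P Q R : Type*} [PartialOrder P] [PartialOrder Q] [PartialOrder R]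

theorem realize_orderComplexMap_id [Finite P] :
    (orderComplexMap (OrderHom.id : P →o P)).realize = ContinuousMap.id _ :=
  ContinuousMap.ext fun x => Subtype.ext (pushCoord_id x.1)

theorem realize_orderComplexMap_comp [Finite P] [Finite Q] [Finite R] (g : Q →o R) (f : P →o Q) :
    (orderComplexMap (g.comp f)).realize =
      (orderComplexMap g).realize.comp (orderComplexMap f).realize :=
  ContinuousMap.ext fun x => Subtype.ext (pushCoord_comp g f x.1)

end Functoriality

section Prism

variable {P : Type*} [PartialOrder P]

theorem mem_realization_orderComplex_iff [Fintype P] {x : P → ℝ} :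
    x ∈ realization (orderComplex P) ↔
      (∀ p, 0 ≤ x p) ∧ ∑ p, x p = 1 ∧ IsChain (· ≤ ·) (Function.support x) := by
  classical
  constructor
  · rintro ⟨hnonneg, s, ⟨-, hchain⟩, hzero, hsum⟩
    refine ⟨hnonneg, ?_, hchain.mono fun p hp => by_contra fun hps => hp (hzero p hps)⟩
    rw [← hsum, Finset.sum_subset s.subset_univ fun p _ => hzero p]
  · rintro ⟨hnonneg, hsum, hchain⟩
    have hsum_support : ∑ p with x p ≠ 0, x p = 1 := by rw [Finset.sum_filter_ne_zero, hsum]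
    refine ⟨hnonneg, ({p | x p ≠ 0} : Finset P), ⟨?_, ?_⟩, by simp, hsum_support⟩
    · exact Finset.nonempty_of_sum_ne_zero (hsum_support ▸ one_ne_zero)
    · rwa [Finset.coe_filter_univ]

/-- The inclusion of a poset `P` as one of the two ends of the prism `P × {false < true}`. -/
def prismEnd (P : Type*) [PartialOrder P] (b : Bool) : P →o P × Bool :=
  OrderHom.id.prod (OrderHom.const P b)

theorem pushCoord_prismEnd (x : P → ℝ) (b c : Bool) (p : P) :
    pushCoord (prismEnd P b) x (p, c) = if c = b then x p else 0 := by
  have hfiber : prismEnd P b ⁻¹' {(p, c)} = if c = b then {p} else ∅ := by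
    ext q
    split_ifs with h <;> simp [prismEnd, h, eq_comm]
  unfold pushCoord
  rw [hfiber]
  split_ifs <;> simp

section LiftedMass

variable [LocallyFiniteOrderTop P]

/-- The part of the mass `x p` that has been lifted at time `t` to the upper end of the prism over
`P`. Mass is lifted from the top of a chain downwards, so nothing is lifted at `p` until
time `∑ q > p, x q`. -/
noncomputable def liftedMass (t : ℝ) (x : P → ℝ) (p : P) : ℝ :=
  min (x p) (max 0 (t - ∑ q ∈ Finset.Ioi p, x q))

variable {t : ℝ} {x : P → ℝ}

theorem liftedMass_le (t : ℝ) (x : P → ℝ) (p : P) : liftedMass t x p ≤ x p :=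
  min_le_left _ _

theorem liftedMass_nonneg (t : ℝ) {p : P} (hp : 0 ≤ x p) : 0 ≤ liftedMass t x p :=
  le_min hp (le_max_left _ _)

theorem liftedMass_eq_zero {p : P} (hp : 0 ≤ x p) (ht : t ≤ ∑ q ∈ Finset.Ioi p, x q) :
    liftedMass t x p = 0 := by
  rw [liftedMass, max_eq_left (sub_nonpos.2 ht), min_eq_right hp]

theorem liftedMass_eq_self {p : P} (ht : ∑ q ∈ Finset.Ici p, x q ≤ t) :
    liftedMass t x p = x p := by
  rw [Finset.Ici_eq_cons_Ioi, Finset.sum_cons] at ht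
  exact min_eq_left (le_max_of_le_right (le_sub_iff_add_le.2 ht))

theorem liftedMass_eq_self_of_lt (hx : ∀ p, 0 ≤ x p) {p q : P} (hpq : p < q)
    (hp : liftedMass t x p ≠ 0) : liftedMass t x q = x q := by
  have hlt : ∑ r ∈ Finset.Ioi p, x r < t := lt_of_not_ge fun h => hp (liftedMass_eq_zero (hx p) h)
  refine liftedMass_eq_self (le_trans ?_ hlt.le)
  have hsub : Finset.Ici q ⊆ Finset.Ioi p := fun _ hr =>
    Finset.mem_Ioi.2 (hpq.trans_le (Finset.mem_Ici.1 hr))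
  exact Finset.sum_le_sum_of_subset_of_nonneg hsub fun r _ _ => hx r

theorem continuous_liftedMass (p : P) :
    Continuous fun y : ℝ × (P → ℝ) => liftedMass y.1 y.2 p := by
  unfold liftedMass
  fun_prop

/-- The distribution of mass on the prism `P × {false < true}` at time `t` of the homotopy that
moves a point `x` of the order complex of `P` from the lower to the upper end. -/
noncomputable def prismCoord (t : ℝ) (x : P → ℝ) : P × Bool → ℝ
  | (p, false) => x p - liftedMass t x p
  | (p, true) => liftedMass t x p

theorem continuous_prismCoord : Continuous fun y : ℝ × (P → ℝ) => prismCoord y.1 y.2 := by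
  have hlift := continuous_liftedMass (P := P)
  refine continuous_pi ?_
  rintro ⟨p, _ | _⟩ <;> simp only [prismCoord] <;> fun_prop

theorem isChain_support_prismCoord (hx : ∀ p, 0 ≤ x p)
    (hchain : IsChain (· ≤ ·) (Function.support x)) :
    IsChain (· ≤ ·) (Function.support (prismCoord t x)) := by
  have hsupport : ∀ p b, prismCoord t x (p, b) ≠ 0 → p ∈ Function.support x := by
    rintro p b hp (hxp : x p = 0)
    have hlift : liftedMass t x p = 0 :=
      le_antisymm (hxp ▸ liftedMass_le t x p) (liftedMass_nonneg t (hx p))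
    cases b <;> simp [prismCoord, hxp, hlift] at hp
  have hlower_le_upper : ∀ p q, prismCoord t x (p, false) ≠ 0 → prismCoord t x (q, true) ≠ 0 →
      p ≤ q := by
    intro p q hp hq
    refine (hchain.total (hsupport p _ hp) (hsupport q _ hq)).elim id fun hqp => ?_
    by_contra hpq
    exact hp (sub_eq_zero.2 (liftedMass_eq_self_of_lt hx (lt_of_le_not_ge hqp hpq) hq).symm)
  rintro ⟨p, b⟩ hp ⟨q, c⟩ hq -
  have htotal : p ≤ q ∨ q ≤ p := hchain.total (hsupport p b hp) (hsupport q c hq)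
  match b, c with
  | false, false | true, true => simpa using htotal
  | false, true => exact Or.inl ⟨hlower_le_upper p q hp hq, Bool.false_le _⟩
  | true, false => exact Or.inr ⟨hlower_le_upper q p hq hp, Bool.false_le _⟩

theorem prismCoord_mem_realization [Finite P] (hx : x ∈ realization (orderComplex P)) :
    prismCoord t x ∈ realization (orderComplex (P × Bool)) := by
  have := Fintype.ofFinite P
  obtain ⟨hnonneg, hsum, hchain⟩ := mem_realization_orderComplex_iff.1 hx
  refine mem_realization_orderComplex_iff.2
    ⟨?_, ?_, isChain_support_prismCoord hnonneg hchain⟩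
  · rintro ⟨p, _ | _⟩
    · exact sub_nonneg.2 (liftedMass_le t x p)
    · exact liftedMass_nonneg t (hnonneg p)
  · simp [Fintype.sum_prod_type, prismCoord, hsum]

theorem prismCoord_zero (hx : ∀ p, 0 ≤ x p) :
    prismCoord 0 x = pushCoord (prismEnd P false) x := by
  have hlift (p : P) : liftedMass 0 x p = 0 :=
    liftedMass_eq_zero (hx p) (Finset.sum_nonneg fun q _ => hx q)
  ext ⟨p, _ | _⟩ <;> simp [prismCoord, pushCoord_prismEnd, hlift]

theorem prismCoord_one [Fintype P] (hx : ∀ p, 0 ≤ x p) (hsum : ∑ p, x p = 1) :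
    prismCoord 1 x = pushCoord (prismEnd P true) x := by
  have hlift (p : P) : liftedMass 1 x p = x p := by
    refine liftedMass_eq_self (hsum ▸ ?_)
    exact Finset.sum_le_univ_sum_of_nonneg hx
  ext ⟨p, _ | _⟩ <;> simp [prismCoord, pushCoord_prismEnd, hlift]

end LiftedMass

theorem homotopic_prismEnd [Finite P] :
    (orderComplexMap (prismEnd P false)).realize.Homotopic
      (orderComplexMap (prismEnd P true)).realize := by
  classical
  have := Fintype.ofFinite P
  let := LocallyFiniteOrderTop.ofIci P (fun p => {q | p ≤ q}) (by simp)
  have hcoe : Continuous fun y : unitInterval × realization (orderComplex P) =>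
      ((y.1 : ℝ), (y.2 : P → ℝ)) := by fun_prop
  refine ⟨⟨⟨fun y => ⟨prismCoord y.1 y.2, prismCoord_mem_realization y.2.2⟩,
    (continuous_prismCoord.comp hcoe).subtype_mk _⟩, ?_, ?_⟩⟩
  · rintro ⟨x, hx⟩
    exact Subtype.ext (prismCoord_zero (mem_realization_orderComplex_iff.1 hx).1)
  · rintro ⟨x, hx⟩
    obtain ⟨hnonneg, hsum, -⟩ := mem_realization_orderComplex_iff.1 hx
    exact Subtype.ext (prismCoord_one hnonneg hsum)

end Prism

section Adjunction

variable {P Q : Type*} [PartialOrder P] [PartialOrder Q] {f g : P →o Q}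

/-- A pair of order-preserving maps `f ≤ g` as a single order-preserving map on the prism
`P × {false < true}`. -/
def prismHom (hfg : f ≤ g) : P × Bool →o Q where
  toFun p := bif p.2 then g p.1 else f p.1
  monotone' := by
    rintro ⟨p, b⟩ ⟨q, c⟩ ⟨hpq : p ≤ q, hbc : b ≤ c⟩
    match b, c with
    | false, false => exact f.monotone hpq
    | false, true => exact (f.monotone hpq).trans (hfg q)
    | true, true => exact g.monotone hpq

theorem homotopic_orderComplexMap_of_le [Finite P] [Finite Q] (hfg : f ≤ g) :
    (orderComplexMap f).realize.Homotopic (orderComplexMap g).realize := by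
  change (orderComplexMap ((prismHom hfg).comp (prismEnd P false))).realize.Homotopic
    (orderComplexMap ((prismHom hfg).comp (prismEnd P true))).realize
  rw [realize_orderComplexMap_comp, realize_orderComplexMap_comp]
  exact (ContinuousMap.Homotopic.refl _).comp homotopic_prismEnd

theorem isHomotopyEquivalence_of_galoisConnection [Finite P] [Finite Q] {l : P →o Q} {u : Q →o P}
    (h : GaloisConnection l u) : IsHomotopyEquivalence (orderComplexMap l).realize := by
  refine ⟨(orderComplexMap u).realize, ?_, ?_⟩
  · rw [← realize_orderComplexMap_comp, ← realize_orderComplexMap_id]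
    exact (homotopic_orderComplexMap_of_le h.le_u_l).symm
  · rw [← realize_orderComplexMap_comp, ← realize_orderComplexMap_id]
    exact homotopic_orderComplexMap_of_le h.l_u_le

end Adjunction

section Nerve

/-- The order-preserving map that sends an element of a poset to the face of all elements below
it, for a complex on the poset in which these sets are faces. -/
def lowerFaceHom {P : Type*} [PartialOrder P] [LocallyFiniteOrderBot P]
    {K : PreAbstractSimplicialComplex P} (hK : ∀ p, Finset.Iic p ∈ K.faces) : P →o K.faces where
  toFun p := ⟨Finset.Iic p, hK p⟩
  monotone' _ _ h := Finset.Iic_subset_Iic.2 h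

theorem galoisConnection_lowerFaceHom {P : Type*} [PartialOrder P] [LocallyFiniteOrderBot P]
    {K : PreAbstractSimplicialComplex P} (hK : ∀ p, Finset.Iic p ∈ K.faces) {F : K.faces → P}
    (hF : ∀ S, IsLUB (S.1 : Set P) (F S)) : GaloisConnection F (lowerFaceHom hK) := by
  intro S p
  rw [isLUB_le_iff (hF S)]
  exact forall₂_congr fun _ _ => Finset.mem_Iic.symm

theorem Iic_mem_nerve_faces {X P : Type*} [Preorder P] [LocallyFiniteOrderBot P] {B : P → Set X}
    (hB : Antitone B) {p : P} (hp : (B p).Nonempty) : Finset.Iic p ∈ (nerve B).faces :=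
  ⟨Finset.nonempty_Iic, hp.mono (Set.subset_iInter₂ fun _ hq => hB (Finset.mem_Iic.1 hq))⟩

theorem antitone_inducedCover {X I : Type*} (A : I → Set X) (P : Set (Finset I)) :
    Antitone (inducedCover A P) :=
  fun _ _ h => Set.biInter_subset_biInter_left h

variable {I : Type*} [DecidableEq I] {P : Set (Finset I)} {K : PreAbstractSimplicialComplex P}

/-- The map `F : S ↦ ⋃ S` of the theorem, for an arbitrary complex `K` on `P` in place of the nerve
of the induced cover. -/
def unionHom (hunion : ∀ S ∈ K.faces, S.biUnion (fun σ => σ.1) ∈ P) : K.faces →o P where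
  toFun S := ⟨S.1.biUnion (fun σ => σ.1), hunion S.1 S.2⟩
  monotone' _ _ h := Finset.biUnion_subset_biUnion_of_subset_left _ h

theorem isLUB_unionHom (hunion : ∀ S ∈ K.faces, S.biUnion (fun σ => σ.1) ∈ P) (S : K.faces) :
    IsLUB (S.1 : Set P) (unionHom hunion S) :=
  ⟨fun _ hσ => Finset.subset_biUnion_of_mem (fun σ : P => σ.1) hσ,
    fun _ hτ => Finset.biUnion_subset.2 fun _ hσ => hτ hσ⟩

end Nerve

end SubposetNerve

open SubposetNerve in
theorem mainTheorem6_general {X I : Type*} [DecidableEq I] (A : I → Set X) (P : Set (Finset I))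
    [Finite P] (hP : ∀ σ ∈ P, (⋂ i ∈ σ, A i).Nonempty)
    (hunion : ∀ S ∈ (nerve (inducedCover A P)).faces, S.biUnion (fun σ => σ.1) ∈ P) :
    ∃ F : (nerve (inducedCover A P)).faces →o P,
      (∀ S, (F S : Finset I) = S.1.biUnion (fun σ => σ.1)) ∧
      IsHomotopyEquivalence (orderComplexMap F).realize := by
  classical
  have hIic (σ : P) : Finset.Iic σ ∈ (nerve (inducedCover A P)).faces :=
    Iic_mem_nerve_faces (antitone_inducedCover A P) (hP σ σ.2)
  exact ⟨unionHom hunion, fun _ => rfl, isHomotopyEquivalence_of_galoisConnection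
    (galoisConnection_lowerFaceHom hIic (isLUB_unionHom hunion))⟩

theorem mainTheorem6 {X I : Type*} [Finite I] [DecidableEq I] (A : I → Set X)
    (P : Set (Finset I)) (hP : P ⊆ (SubposetNerve.nerve A).faces)
    (hunion : ∀ S ∈ (SubposetNerve.nerve (SubposetNerve.inducedCover A P)).faces,
      S.biUnion (fun σ => σ.1) ∈ P) :
    ∃ F : (SubposetNerve.nerve (SubposetNerve.inducedCover A P)).faces →o P,
      (∀ S, (F S : Finset I) = S.1.biUnion (fun σ => σ.1)) ∧
      SubposetNerve.IsHomotopyEquivalence (SubposetNerve.orderComplexMap F).realize :=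
  mainTheorem6_general A P (fun _ hσ => (hP hσ).2) hunion
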